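/- For $r\in(0,1)$ write $r^\ast=1-r$. The \emph{Giry monoidal structure} on $\mathbf{Set}$ is the symmetric monoidal structure with tensor $$A\star B \;=\; A+\big((0,1)\times A\times B\big)+B,\qquad f\star g=f+\big((0,1)\times f\times g\big)+g,$$ with unit $\emptyset$ and the evident unit constraints. Write $\iota_1(a)$, $(r,a,b)$, $\iota_2(b)$ for the elements of the three summands. The associativity constraint $(A\star B)\star C\to A\star(B\star C)$ sends $(r,(s,a,b),c)$ to $\big(rs,\,a,\,(\tfrac{r s^\ast}{(rs)^\ast},b,c)\big)$ and is the identity between corresponding summands otherwise (the summands $A$, $B$, $C$, $(0,1)\times A\times B$, $(0,1)\times A\times C$, $(0,1)\times B\times C$). The symmetry $A\star B\to B\star A$ exchanges the outer summands and sends $(r,a,b)$ to $(r^\ast,b,a)$. The \emph{finite Giry monad} $D$ on $\mathbf{Set}$ sends $A$ to the set of finitely supported probability distributions on $A$, and a function to pushforward along it; its unit sends $a$ to the point mass at $a$, and its multiplication sends $\sum_i\lambda_i\cdot\omega_i$ to $a\mapsto\sum_i\lambda_i\omega_i(a)$. A \emph{symmetric opmonoidal} structure on a monad $T$ on a symmetric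 monoidal category $(\mathcal C,\otimes,I)$ consists of maps $\upsilon_I\colon TI\to I$ and natural maps $\upsilon_{XY}\colon T(X\otimes Y)\to TX\otimes TY$ making $T$ a symmetric opmonoidal functor, such that the unit and the multiplication of $T$ are opmonoidal transformations. The symmetric monoidal structure of $\mathcal C$ then lifts to the category $\mathcal C^T$ of $T$-algebras: the unit is $\upsilon_I\colon TI\to I$, the tensor of $x\colon TX\to X$ and $y\colon TY\to Y$ is $(x\otimes y)\circ\upsilon_{XY}\colon T(X\otimes Y)\to X\otimes Y$, and the tensor of maps and the constraints are those of $\mathcal C$. The monad $T$ is a \emph{linear exponential monad} if this lifted symmetric monoidal structure on $\mathcal C^T$ is given by finite coproducts, i.e. its unit is initial, its tensor is binary coproduct, and its action on maps and its constraints are the ones induced by the universal properties. \textbf{Proposition.} With respect to the Giry monoidal structure on $\mathbf{Set}$, the finite Giry monad $D$ is a linear exponential monad. In other words, the Giry monoidal structure lifts along the forgetful functor $U\colon\mathbf{Set}^D\to\mathbf{Set}$ from $D$-algebras (convex spaces), so that $U$ is strict symmetric monoidal, and the lifted structure on $\mathbf{Set}^D$ is that of finite coproducts. More precisely, this holds for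 a symmetric opmonoidal structure on $D$ such that, for all $D$-algebras $X$ and $Y$, the coproduct injections into the algebra $X\star Y$ are $\iota_1$ and $\iota_2$, and the convex combination $r\cdot\iota_1(x)+r^\ast\cdot\iota_2(y)$ computed in $X\star Y$ is $(r,x,y)$, for all $r\in(0,1)$, $x\in X$, $y\in Y$. -/

import Mathlib

open CategoryTheory MonoidalCategory Limits

universe v u v' u'

section Opmonoidal

variable {C : Type u} [Category.{v} C] [MonoidalCategory C] [SymmetricCategory C]

/-- A symmetric opmonoidal structure on a monad `T` on a symmetric monoidal category: maps
`υ_I : T I ⟶ I` (the field `η` of `oplax`) and `υ_{X,Y} : T (X ⊗ Y) ⟶ T X ⊗ T Y` (the field `δ` of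
`oplax`) making `T` a symmetric opmonoidal functor, for which the unit and the multiplication of
the monad are opmonoidal natural transformations. -/
structure SymmetricOpmonoidalMonad (T : Monad C) where
  oplax : T.toFunctor.OplaxMonoidal
  braided : ∀ X Y : C, oplax.δ X Y ≫ (β_ (T.obj X) (T.obj Y)).hom =
    T.map (β_ X Y).hom ≫ oplax.δ Y X
  unit_counit : T.η.app (𝟙_ C) ≫ oplax.η = 𝟙 (𝟙_ C)
  unit_tensor : ∀ X Y : C, T.η.app (X ⊗ Y) ≫ oplax.δ X Y = T.η.app X ⊗ₘ T.η.app Y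
  mul_counit : T.μ.app (𝟙_ C) ≫ oplax.η = T.map oplax.η ≫ oplax.η
  mul_tensor : ∀ X Y : C, T.μ.app (X ⊗ Y) ≫ oplax.δ X Y =
    T.map (oplax.δ X Y) ≫ oplax.δ (T.obj X) (T.obj Y) ≫ (T.μ.app X ⊗ₘ T.μ.app Y)

namespace SymmetricOpmonoidalMonad

variable {T : Monad C} (S : SymmetricOpmonoidalMonad T)

theorem δ_natural {X Y X' Y' : C} (f : X ⟶ X') (g : Y ⟶ Y') :
    S.oplax.δ X Y ≫ (T.map f ⊗ₘ T.map g) = T.map (f ⊗ₘ g) ≫ S.oplax.δ X' Y' := by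
  let := S.oplax
  exact Functor.OplaxMonoidal.δ_natural T.toFunctor f g

/-- The lifted tensor product of two algebras: the carrier is `X ⊗ Y`, and the action is
`T (X ⊗ Y) ⟶ T X ⊗ T Y ⟶ X ⊗ Y`. -/
abbrev tensorAlgebra (X Y : T.Algebra) : T.Algebra where
  A := X.A ⊗ Y.A
  a := S.oplax.δ X.A Y.A ≫ (X.a ⊗ₘ Y.a)
  unit := by
    rw [← Category.assoc, S.unit_tensor, tensorHom_comp_tensorHom, X.unit, Y.unit]
    simp
  assoc := by
    rw [← Category.assoc, S.mul_tensor, Functor.map_comp, Category.assoc, Category.assoc,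
      Category.assoc, tensorHom_comp_tensorHom, X.assoc, Y.assoc, ← tensorHom_comp_tensorHom,
      ← Category.assoc (S.oplax.δ (T.obj X.A) (T.obj Y.A)), S.δ_natural, Category.assoc]

/-- The lifted unit object: the carrier is `I`, and the action is `υ_I`. -/
abbrev unitAlgebra : T.Algebra where
  A := 𝟙_ C
  a := S.oplax.η
  unit := S.unit_counit
  assoc := S.mul_counit

/-- The lifted tensor product of two algebra maps. -/
abbrev tensorAlgebraHom {X X' Y Y' : T.Algebra} (f : X ⟶ X') (g : Y ⟶ Y') :
    S.tensorAlgebra X Y ⟶ S.tensorAlgebra X' Y' where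
  f := f.f ⊗ₘ g.f
  h := by
    rw [← Category.assoc, ← S.δ_natural, Category.assoc, Category.assoc,
      tensorHom_comp_tensorHom, tensorHom_comp_tensorHom, f.h, g.h]

theorem associator_action (X Y Z : T.Algebra) :
    T.map (α_ X.A Y.A Z.A).hom ≫ (S.tensorAlgebra X (S.tensorAlgebra Y Z)).a =
      (S.tensorAlgebra (S.tensorAlgebra X Y) Z).a ≫ (α_ X.A Y.A Z.A).hom := by
  have h := S.oplax.oplax_associativity X.A Y.A Z.A
  have e1 : (X.a ⊗ₘ S.oplax.δ Y.A Z.A ≫ (Y.a ⊗ₘ Z.a)) =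
      (T.obj X.A ◁ S.oplax.δ Y.A Z.A) ≫ (X.a ⊗ₘ (Y.a ⊗ₘ Z.a)) := by
    rw [← id_tensorHom, tensorHom_comp_tensorHom, Category.id_comp]
  have e2 : ((S.oplax.δ X.A Y.A ≫ (X.a ⊗ₘ Y.a)) ⊗ₘ Z.a) =
      (S.oplax.δ X.A Y.A ▷ T.obj Z.A) ≫ ((X.a ⊗ₘ Y.a) ⊗ₘ Z.a) := by
    rw [← tensorHom_id, tensorHom_comp_tensorHom, Category.id_comp]
  change T.map (α_ X.A Y.A Z.A).hom ≫ S.oplax.δ X.A (Y.A ⊗ Z.A) ≫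
      (X.a ⊗ₘ S.oplax.δ Y.A Z.A ≫ (Y.a ⊗ₘ Z.a)) =
    (S.oplax.δ (X.A ⊗ Y.A) Z.A ≫ ((S.oplax.δ X.A Y.A ≫ (X.a ⊗ₘ Y.a)) ⊗ₘ Z.a)) ≫
      (α_ X.A Y.A Z.A).hom
  rw [e1, e2]
  simp only [Category.assoc]
  rw [associator_naturality]
  simpa only [Category.assoc] using (congrArg (· ≫ (X.a ⊗ₘ (Y.a ⊗ₘ Z.a))) h).symm

theorem leftUnitor_action (X : T.Algebra) :
    T.map (λ_ X.A).hom ≫ X.a = (S.tensorAlgebra S.unitAlgebra X).a ≫ (λ_ X.A).hom := by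
  let := S.oplax
  have h := Functor.OplaxMonoidal.left_unitality_hom T.toFunctor X.A
  change _ = (S.oplax.δ (𝟙_ C) X.A ≫ (S.oplax.η ⊗ₘ X.a)) ≫ (λ_ X.A).hom
  rw [← h, MonoidalCategory.tensorHom_def]
  simp only [Category.assoc, leftUnitor_naturality]

theorem rightUnitor_action (X : T.Algebra) :
    T.map (ρ_ X.A).hom ≫ X.a = (S.tensorAlgebra X S.unitAlgebra).a ≫ (ρ_ X.A).hom := by
  let := S.oplax
  have h := Functor.OplaxMonoidal.right_unitality_hom T.toFunctor X.A
  change _ = (S.oplax.δ X.A (𝟙_ C) ≫ (X.a ⊗ₘ S.oplax.η)) ≫ (ρ_ X.A).hom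
  rw [← h, MonoidalCategory.tensorHom_def']
  simp only [Category.assoc, rightUnitor_naturality]

theorem braiding_action (X Y : T.Algebra) :
    T.map (β_ X.A Y.A).hom ≫ (S.tensorAlgebra Y X).a =
      (S.tensorAlgebra X Y).a ≫ (β_ X.A Y.A).hom := by
  rw [← Category.assoc, ← S.braided, Category.assoc, Category.assoc,
    BraidedCategory.braiding_naturality]

/-- The data of the lifted monoidal structure on algebras: all of it lies over the data of `C`. -/
abbrev liftedStruct : MonoidalCategoryStruct T.Algebra where
  tensorObj X Y := S.tensorAlgebra X Y
  tensorUnit := S.unitAlgebra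
  tensorHom f g := S.tensorAlgebraHom f g
  whiskerLeft X _ _ g := S.tensorAlgebraHom (𝟙 X) g
  whiskerRight f Y := S.tensorAlgebraHom f (𝟙 Y)
  associator X Y Z := Monad.Algebra.isoMk (α_ X.A Y.A Z.A) (S.associator_action X Y Z)
  leftUnitor X := Monad.Algebra.isoMk (λ_ X.A) (S.leftUnitor_action X)
  rightUnitor X := Monad.Algebra.isoMk (ρ_ X.A) (S.rightUnitor_action X)

/-- The lifted monoidal structure on algebras. -/
abbrev liftedMonoidal : MonoidalCategory T.Algebra :=
  letI := S.liftedStruct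
  .ofTensorHom
    (id_tensorHom_id := fun X Y => Monad.Algebra.Hom.ext (id_tensorHom_id X.A Y.A))
    (id_tensorHom := fun _ _ _ _ => rfl)
    (tensorHom_id := fun _ _ => rfl)
    (tensorHom_comp_tensorHom := fun f₁ f₂ g₁ g₂ =>
      Monad.Algebra.Hom.ext (tensorHom_comp_tensorHom f₁.f f₂.f g₁.f g₂.f))
    (associator_naturality := fun f g h =>
      Monad.Algebra.Hom.ext (associator_naturality f.f g.f h.f))
    (leftUnitor_naturality := fun f => Monad.Algebra.Hom.ext
      ((congrArg (· ≫ _) (id_tensorHom _ f.f)).trans (leftUnitor_naturality f.f)))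
    (rightUnitor_naturality := fun f => Monad.Algebra.Hom.ext
      ((congrArg (· ≫ _) (tensorHom_id f.f _)).trans (rightUnitor_naturality f.f)))
    (pentagon := fun W X Y Z => Monad.Algebra.Hom.ext <| by
      have h := MonoidalCategory.pentagon W.A X.A Y.A Z.A
      rw [← id_tensorHom, ← tensorHom_id] at h
      exact h)
    (triangle := fun X Y => Monad.Algebra.Hom.ext <| by
      have h := MonoidalCategory.triangle X.A Y.A
      rw [← id_tensorHom, ← tensorHom_id] at h
      exact h)

/-- The lifted symmetry on algebras. -/
abbrev liftedSymmetric :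
    letI := S.liftedMonoidal
    SymmetricCategory T.Algebra :=
  letI := S.liftedMonoidal
  { braiding := fun X Y => Monad.Algebra.isoMk (β_ X.A Y.A) (S.braiding_action X Y)
    braiding_naturality_right := fun X _ _ f => Monad.Algebra.Hom.ext <| by
      have h := BraidedCategory.braiding_naturality_right X.A f.f
      rw [← id_tensorHom, ← tensorHom_id] at h
      exact h
    braiding_naturality_left := fun f Z => Monad.Algebra.Hom.ext <| by
      have h := BraidedCategory.braiding_naturality_left f.f Z.A
      rw [← id_tensorHom, ← tensorHom_id] at h
      exact h
    hexagon_forward := fun X Y Z => Monad.Algebra.Hom.ext <| by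
      have h := BraidedCategory.hexagon_forward X.A Y.A Z.A
      rw [← id_tensorHom, ← tensorHom_id] at h
      exact h
    hexagon_reverse := fun X Y Z => Monad.Algebra.Hom.ext <| by
      have h := BraidedCategory.hexagon_reverse X.A Y.A Z.A
      rw [← id_tensorHom, ← tensorHom_id] at h
      exact h
    symmetry := fun X Y => Monad.Algebra.Hom.ext (SymmetricCategory.symmetry X.A Y.A) }

end SymmetricOpmonoidalMonad

end Opmonoidal
section Linear

variable (C : Type u) [Category.{v} C] [MonoidalCategory C] [SymmetricCategory C]

/-- The symmetric monoidal structure of `C` is given by finite coproducts: the unit is an initial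
object, `X ⊗ Y` is a coproduct of `X` and `Y` with injections `inl` and `inr`, and the tensor
product of maps and all the constraint isomorphisms are the ones that the universal properties
induce. -/
structure FiniteCoproductStructure where
  isInitialUnit : IsInitial (𝟙_ C)
  inl (X Y : C) : X ⟶ X ⊗ Y
  inr (X Y : C) : Y ⟶ X ⊗ Y
  isColimit (X Y : C) : IsColimit (BinaryCofan.mk (inl X Y) (inr X Y))
  inl_tensorHom {X Y X' Y' : C} (f : X ⟶ X') (g : Y ⟶ Y') :
    inl X Y ≫ (f ⊗ₘ g) = f ≫ inl X' Y'
  inr_tensorHom {X Y X' Y' : C} (f : X ⟶ X') (g : Y ⟶ Y') :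
    inr X Y ≫ (f ⊗ₘ g) = g ≫ inr X' Y'
  inr_leftUnitor (X : C) : inr (𝟙_ C) X ≫ (λ_ X).hom = 𝟙 X
  inl_rightUnitor (X : C) : inl X (𝟙_ C) ≫ (ρ_ X).hom = 𝟙 X
  inl_inl_associator (X Y Z : C) :
    inl X Y ≫ inl (X ⊗ Y) Z ≫ (α_ X Y Z).hom = inl X (Y ⊗ Z)
  inr_inl_associator (X Y Z : C) :
    inr X Y ≫ inl (X ⊗ Y) Z ≫ (α_ X Y Z).hom = inl Y Z ≫ inr X (Y ⊗ Z)
  inr_associator (X Y Z : C) :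
    inr (X ⊗ Y) Z ≫ (α_ X Y Z).hom = inr Y Z ≫ inr X (Y ⊗ Z)
  inl_braiding (X Y : C) : inl X Y ≫ (β_ X Y).hom = inr Y X
  inr_braiding (X Y : C) : inr X Y ≫ (β_ X Y).hom = inl Y X

variable {C}

/-- A linear exponential monad on a symmetric monoidal category: a symmetric opmonoidal monad whose
lifted symmetric monoidal structure on the category of algebras is given by finite coproducts. -/
structure LinearExponentialMonad (T : Monad C) extends SymmetricOpmonoidalMonad T where
  coproducts :
    letI := toSymmetricOpmonoidalMonad.liftedMonoidal
    letI := toSymmetricOpmonoidalMonad.liftedSymmetric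
    FiniteCoproductStructure T.Algebra

/-- A functor between symmetric monoidal categories is strict symmetric monoidal: it preserves the
unit, the tensor product of objects and of maps, and all the constraint isomorphisms on the
nose. -/
structure IsStrictSymmetricMonoidal {D : Type u'} [Category.{v'} D] [MonoidalCategory D]
    [SymmetricCategory D] (F : C ⥤ D) : Prop where
  unit : F.obj (𝟙_ C) = 𝟙_ D
  tensor (X Y : C) : F.obj (X ⊗ Y) = F.obj X ⊗ F.obj Y
  tensorHom {X Y X' Y' : C} (f : X ⟶ X') (g : Y ⟶ Y') :
    F.map (f ⊗ₘ g) =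
      eqToHom (tensor X Y) ≫ (F.map f ⊗ₘ F.map g) ≫ eqToHom (tensor X' Y').symm
  associator (X Y Z : C) :
    F.map (α_ X Y Z).hom =
      eqToHom (by rw [tensor, tensor]) ≫ (α_ (F.obj X) (F.obj Y) (F.obj Z)).hom ≫
        eqToHom (by rw [tensor, tensor])
  leftUnitor (X : C) :
    F.map (λ_ X).hom = eqToHom (by rw [tensor, unit]) ≫ (λ_ (F.obj X)).hom
  rightUnitor (X : C) :
    F.map (ρ_ X).hom = eqToHom (by rw [tensor, unit]) ≫ (ρ_ (F.obj X)).hom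
  braiding (X Y : C) :
    F.map (β_ X Y).hom =
      eqToHom (tensor X Y) ≫ (β_ (F.obj X) (F.obj Y)).hom ≫ eqToHom (tensor Y X).symm

end Linear

namespace Giry

/-- The open unit interval `(0,1)`. -/
abbrev Weight : Type := Set.Ioo (0 : ℝ) 1

/-- `r ↦ r* = 1 - r` on `(0,1)`. -/
def compl (r : Weight) : Weight :=
  ⟨1 - r.1, by have := r.2.1; have := r.2.2; constructor <;> linarith⟩

/-- The first component `r s` of `v (r, s)`. -/
def vFst (r s : Weight) : Weight :=
  ⟨r.1 * s.1, mul_pos r.2.1 s.2.1, by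
    have := r.2.1; have := r.2.2; have := s.2.1; have := s.2.2; nlinarith⟩

/-- The second component `r s* / (r s)*` of `v (r, s)`. -/
noncomputable def vSnd (r s : Weight) : Weight :=
  ⟨r.1 * (1 - s.1) / (1 - r.1 * s.1), by
    have h1 := r.2.1
    have h2 := r.2.2
    have h3 := s.2.1
    have h4 := s.2.2
    have h5 : 0 < 1 - r.1 * s.1 := by nlinarith
    refine ⟨div_pos (mul_pos h1 (by linarith)) h5, ?_⟩
    rw [div_lt_one h5]
    nlinarith⟩

/-- The first component `p + q p*` of `v⁻¹ (p, q)`. -/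
def vInvFst (p q : Weight) : Weight :=
  ⟨p.1 + q.1 * (1 - p.1), by
    have := p.2.1; have := p.2.2; have := q.2.1; have := q.2.2
    constructor <;> nlinarith⟩

/-- The second component `p / (p + q p*)` of `v⁻¹ (p, q)`. -/
noncomputable def vInvSnd (p q : Weight) : Weight :=
  ⟨p.1 / (p.1 + q.1 * (1 - p.1)), by
    have h1 := p.2.1
    have h2 := p.2.2
    have h3 := q.2.1
    have h5 : 0 < q.1 * (1 - p.1) := mul_pos h3 (by linarith)
    refine ⟨div_pos h1 (by linarith), ?_⟩
    rw [div_lt_one (by linarith)]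
    linarith⟩

theorem mul_ne_one' (r s : Weight) : 1 - r.1 * s.1 ≠ 0 :=
  (sub_pos.2 (vFst r s).2.2).ne'

theorem den_ne (p q : Weight) : p.1 + q.1 * (1 - p.1) ≠ 0 := (vInvFst p q).2.1.ne'

theorem vInvFst_v (r s : Weight) : vInvFst (vFst r s) (vSnd r s) = r := by
  have h := mul_ne_one' r s
  apply Subtype.ext
  simp only [vInvFst, vFst, vSnd]
  field_simp
  ring

theorem vInvSnd_v (r s : Weight) : vInvSnd (vFst r s) (vSnd r s) = s := by
  have h := congrArg Subtype.val (vInvFst_v r s)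
  apply Subtype.ext
  simp only [vInvFst, vFst, vSnd] at h
  simp only [vInvSnd, vFst, vSnd, h]
  have := r.2.1.ne'
  field_simp

theorem vFst_vInv (p q : Weight) : vFst (vInvFst p q) (vInvSnd p q) = p := by
  have h := den_ne p q
  apply Subtype.ext
  simp only [vInvFst, vFst, vInvSnd]
  field_simp

theorem vSnd_vInv (p q : Weight) : vSnd (vInvFst p q) (vInvSnd p q) = q := by
  have h := den_ne p q
  have h2 : 1 - p.1 ≠ 0 := (compl p).2.1.ne'
  apply Subtype.ext
  simp only [vInvFst, vSnd, vInvSnd]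
  rw [mul_div_cancel₀ _ h, mul_sub, mul_div_cancel₀ _ h]
  field_simp
  ring

/-- The three components of the tricocycloid axiom for `v`. -/
theorem tri₁ (r s t : Weight) : vFst (vFst r s) t = vFst r (vFst s t) := by
  apply Subtype.ext; simp only [vFst]; ring

theorem tri₂ (r s t : Weight) :
    vSnd (vFst r s) t = vFst (vSnd r (vFst s t)) (vSnd s t) := by
  have h1 := mul_ne_one' s t
  have h2 := mul_ne_one' r (vFst s t)
  have h3 := mul_ne_one' (vFst r s) t
  apply Subtype.ext
  simp only [vFst, vSnd] at *
  field_simp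

theorem tri₃ (r s t : Weight) :
    vSnd r s = vSnd (vSnd r (vFst s t)) (vSnd s t) := by
  have h1 := mul_ne_one' s t
  have h2 := mul_ne_one' r (vFst s t)
  have h4 := mul_ne_one' r s
  have h3 := mul_ne_one' (vSnd r (vFst s t)) (vSnd s t)
  have h5 : 1 - (vFst (vSnd r (vFst s t)) (vSnd s t)).1 =
      (1 - r.1 * s.1) / (1 - r.1 * (s.1 * t.1)) := by
    rw [← tri₂]; simp only [vFst, vSnd] at *
    rw [← mul_assoc] at *
    field_simp; ring
  apply Subtype.ext
  simp only [vFst, vSnd] at *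
  rw [h5]
  rw [← mul_assoc] at h2 ⊢
  have h6 : 1 - s.1 * (1 - t.1) / (1 - s.1 * t.1) = (1 - s.1) / (1 - s.1 * t.1) := by
    field_simp
    ring
  rw [h6]
  field_simp

theorem compl_compl (r : Weight) : compl (compl r) = r := by
  apply Subtype.ext; simp [compl]

/-- The two components of the symmetry axiom for `r ↦ r*`. -/
theorem sym₁ (r s : Weight) :
    vFst r (compl s) = vFst (compl (vFst r s)) (vSnd r s) := by
  have h := mul_ne_one' r s
  apply Subtype.ext
  simp only [vFst, vSnd, compl] at *
  field_simp

theorem sym₂ (r s : Weight) :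
    compl (vSnd r (compl s)) = vSnd (compl (vFst r s)) (vSnd r s) := by
  have h := mul_ne_one' r s
  have h2 := mul_ne_one' r (compl s)
  have h3 : (1 - r.1 * s.1) * (r.1 * (1 - s.1) / (1 - r.1 * s.1)) = r.1 * (1 - s.1) := by
    field_simp
  apply Subtype.ext
  simp only [vFst, vSnd, compl] at *
  rw [h3, mul_sub (1 - r.1 * s.1), h3]
  field_simp
  ring

/-- `A ⋆ B = A + (0,1) × A × B + B`. -/
abbrev Star (A B : Type u) : Type u := A ⊕ (Weight × A × B) ⊕ B

/-- `f ⋆ g = f + (0,1) × f × g + g`. -/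
def starMap {A A' B B' : Type u} (f : A → A') (g : B → B') : Star A B → Star A' B' :=
  Sum.map f (Sum.map (Prod.map id (Prod.map f g)) g)

/-- The associativity constraint: it is the identity on the summands `A`, `B`, `C`, `HAB`, `HAC`,
`HBC` (with `H = (0,1)`), and is given by `v` on the summand `HHABC`. -/
noncomputable def assocFun {A B C : Type u} : Star (Star A B) C → Star A (Star B C)
  | .inl (.inl a) => .inl a
  | .inl (.inr (.inl (r, a, b))) => .inr (.inl (r, a, .inl b))
  | .inl (.inr (.inr b)) => .inr (.inr (.inl b))
  | .inr (.inl (r, .inl a, c)) => .inr (.inl (r, a, .inr (.inr c)))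
  | .inr (.inl (r, .inr (.inl (s, a, b)), c)) =>
      .inr (.inl (vFst r s, a, .inr (.inl (vSnd r s, b, c))))
  | .inr (.inl (r, .inr (.inr b), c)) => .inr (.inr (.inr (.inl (r, b, c))))
  | .inr (.inr c) => .inr (.inr (.inr (.inr c)))

/-- The inverse of the associativity constraint. -/
noncomputable def assocInv {A B C : Type u} : Star A (Star B C) → Star (Star A B) C
  | .inl a => .inl (.inl a)
  | .inr (.inl (r, a, .inl b)) => .inl (.inr (.inl (r, a, b)))
  | .inr (.inr (.inl b)) => .inl (.inr (.inr b))
  | .inr (.inl (r, a, .inr (.inr c))) => .inr (.inl (r, .inl a, c))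
  | .inr (.inl (p, a, .inr (.inl (q, b, c)))) =>
      .inr (.inl (vInvFst p q, .inr (.inl (vInvSnd p q, a, b)), c))
  | .inr (.inr (.inr (.inl (r, b, c)))) => .inr (.inl (r, .inr (.inr b), c))
  | .inr (.inr (.inr (.inr c))) => .inr (.inr c)

/-- The associativity constraint as a bijection. -/
noncomputable def assocEquiv (A B C : Type u) : Star (Star A B) C ≃ Star A (Star B C) where
  toFun := assocFun
  invFun := assocInv
  left_inv := by
    rintro ((a | ⟨r, a, b⟩ | b) | ⟨r, a | ⟨s, a, b⟩ | b, c⟩ | c) <;>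
      simp [assocFun, assocInv, vInvFst_v, vInvSnd_v]
  right_inv := by
    rintro (a | ⟨r, a, b | ⟨s, b, c⟩ | c⟩ | b | ⟨r, b, c⟩ | c) <;>
      simp [assocFun, assocInv, vFst_vInv, vSnd_vInv]

/-- The left unit constraint `0 ⋆ A ≅ A`. -/
def leftUnitEquiv (A : Type u) : Star PEmpty.{u + 1} A ≃ A where
  toFun
    | .inl e => e.elim
    | .inr (.inl (_, e, _)) => e.elim
    | .inr (.inr a) => a
  invFun a := .inr (.inr a)
  left_inv := by rintro (⟨⟨⟩⟩ | ⟨_, ⟨⟩, _⟩ | a); rfl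
  right_inv _ := rfl

/-- The right unit constraint `A ⋆ 0 ≅ A`. -/
def rightUnitEquiv (A : Type u) : Star A PEmpty.{u + 1} ≃ A where
  toFun
    | .inl a => a
    | .inr (.inl (_, _, e)) => e.elim
    | .inr (.inr e) => e.elim
  invFun a := .inl a
  left_inv := by rintro (a | ⟨_, _, ⟨⟩⟩ | ⟨⟨⟩⟩); rfl
  right_inv _ := rfl

/-- The symmetry `A ⋆ B → B ⋆ A`, given by `r ↦ r*` on the middle summand. -/
def swapFun {A B : Type u} : Star A B → Star B A
  | .inl a => .inr (.inr a)
  | .inr (.inl (r, a, b)) => .inr (.inl (compl r, b, a))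
  | .inr (.inr b) => .inl b

theorem swapFun_swapFun {A B : Type u} (x : Star A B) : swapFun (swapFun x) = x := by
  rcases x with a | ⟨r, a, b⟩ | b <;> simp [swapFun, compl_compl]

/-- The symmetry as a bijection. -/
def swapEquiv (A B : Type u) : Star A B ≃ Star B A where
  toFun := swapFun
  invFun := swapFun
  left_inv := swapFun_swapFun
  right_inv := swapFun_swapFun

/-- The data of the Giry monoidal structure `(⋆, 0)` on sets. -/
noncomputable abbrev monoidalStruct : MonoidalCategoryStruct (Type u) where
  tensorObj A B := Star A B
  tensorUnit := PEmpty
  tensorHom f g := ↾(starMap f g)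
  whiskerLeft _ _ _ g := ↾(starMap id g)
  whiskerRight f _ := ↾(starMap f id)
  associator A B C := (assocEquiv A B C).toIso
  leftUnitor A := (leftUnitEquiv A).toIso
  rightUnitor A := (rightUnitEquiv A).toIso

theorem starMap_id {A B : Type u} (x : Star A B) : starMap id id x = x := by
  rcases x with a | ⟨r, a, b⟩ | b <;> rfl

theorem starMap_comp {A A' A'' B B' B'' : Type u} (f : A → A') (f' : A' → A'') (g : B → B')
    (g' : B' → B'') (x : Star A B) :
    starMap f' g' (starMap f g x) = starMap (f' ∘ f) (g' ∘ g) x := by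
  rcases x with a | ⟨r, a, b⟩ | b <;> rfl

theorem assoc_natural {A A' B B' C C' : Type u} (f : A → A') (g : B → B') (h : C → C')
    (x : Star (Star A B) C) :
    assocFun (starMap (starMap f g) h x) = starMap f (starMap g h) (assocFun x) := by
  rcases x with (a | ⟨r, a, b⟩ | b) | ⟨r, a | ⟨s, a, b⟩ | b, c⟩ | c <;> rfl

theorem assoc_pentagon {A B C D : Type u} (x : Star (Star (Star A B) C) D) :
    starMap id assocFun (assocFun (starMap assocFun id x)) =
      (assocFun (assocFun x) : Star A (Star B (Star C D))) := by
  rcases x with ((a | ⟨r, a, b⟩ | b) | ⟨r, a | ⟨s, a, b⟩ | b, c⟩ | c) |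
      ⟨t, (a | ⟨r, a, b⟩ | b) | ⟨r, a | ⟨s, a, b⟩ | b, c⟩ | c, d⟩ | d <;>
    first
    | rfl
    | simp [starMap, assocFun, tri₁, ← tri₂, ← tri₃]

theorem hexagon {A B C : Type u} (x : Star (Star A B) C) :
    (assocFun (swapFun (assocFun x)) : Star B (Star C A)) =
      starMap id swapFun (assocFun (starMap swapFun id x)) := by
  rcases x with (a | ⟨r, a, b⟩ | b) | ⟨r, a | ⟨s, a, b⟩ | b, c⟩ | c <;>
    first
    | rfl
    | simp [starMap, assocFun, swapFun, ← sym₁, ← sym₂]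

theorem hexagon_inv {A B C : Type u} (x : Star A (Star B C)) :
    (assocInv (swapFun (assocInv x)) : Star (Star C A) B) =
      starMap swapFun id (assocInv (starMap id swapFun x)) := by
  have e : ∀ {A B : Type u}, swapFun ∘ (swapFun : Star A B → Star B A) = id :=
    funext swapFun_swapFun
  have h := hexagon (starMap swapFun id (assocInv (starMap id swapFun x)))
  have h₁ : ∀ y : Star A (Star C B), assocFun (assocInv y) = y := (assocEquiv A C B).right_inv
  have h₂ : ∀ y : Star (Star A B) C, assocInv (assocFun y) = y := (assocEquiv A B C).left_inv
  have h₃ : ∀ y : Star (Star C A) B, assocInv (assocFun y) = y := (assocEquiv C A B).left_inv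
  rw [starMap_comp, e, Function.id_comp, starMap_id, h₁, starMap_comp, e, Function.id_comp,
    starMap_id] at h
  rw [← h, h₂, swapFun_swapFun, h₃, h]

/-- The Giry monoidal structure `(⋆, 0)` on sets. -/
noncomputable abbrev monoidal : MonoidalCategory (Type u) :=
  letI := monoidalStruct.{u}
  .ofTensorHom
    (id_tensorHom_id := fun A B => by ext x; exact starMap_id x)
    (id_tensorHom := fun _ _ _ _ => rfl)
    (tensorHom_id := fun _ _ => rfl)
    (tensorHom_comp_tensorHom := fun f₁ f₂ g₁ g₂ => by ext x; exact starMap_comp _ _ _ _ x)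
    (associator_naturality := fun f g h => by ext x; exact assoc_natural f g h x)
    (leftUnitor_naturality := fun f => by ext x; rcases x with ⟨⟨⟩⟩ | ⟨_, ⟨⟩, _⟩ | a; rfl)
    (rightUnitor_naturality := fun f => by ext x; rcases x with a | ⟨_, _, ⟨⟩⟩ | ⟨⟨⟩⟩; rfl)
    (pentagon := fun A B C D => by ext x; exact assoc_pentagon x)
    (triangle := fun A B => by
      ext x
      rcases x with (a | ⟨_, _, ⟨⟩⟩ | ⟨⟨⟩⟩) | ⟨r, a | ⟨_, _, ⟨⟩⟩ | ⟨⟨⟩⟩, c⟩ | c <;> rfl)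

/-- The symmetry of the Giry monoidal structure. -/
noncomputable abbrev symmetric :
    letI := monoidal.{u}
    SymmetricCategory (Type u) :=
  letI := monoidal.{u}
  { braiding := fun A B => (swapEquiv A B).toIso
    braiding_naturality_right := fun A B C f => by
      ext x; rcases x with a | ⟨r, a, b⟩ | b <;> rfl
    braiding_naturality_left := fun f Z => by
      ext x; rcases x with a | ⟨r, a, b⟩ | b <;> rfl
    hexagon_forward := fun A B C => by ext x; exact hexagon x
    hexagon_reverse := fun A B C => by
      ext x
      exact hexagon_inv x
    symmetry := fun A B => by ext x; exact swapFun_swapFun x }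

theorem join_map_single {A : Type u} (x : Convexity.StdSimplex ℝ A) :
    (x.map Convexity.StdSimplex.single).join = x := by
  apply Convexity.StdSimplex.ext
  rw [Convexity.StdSimplex.weights_join, Convexity.StdSimplex.weights_map,
    Finsupp.sum_mapDomain_index (by simp) (by simp [add_smul])]
  simp

/-- The finite Giry monad: `D A` is the set of finitely supported probability distributions on `A`,
`D f` is pushforward, the unit sends `a` to the point mass at `a`, and the multiplication sends
`∑ λᵢ · ωᵢ` to `a ↦ ∑ λᵢ ωᵢ(a)`. -/
noncomputable def monad : Monad (Type u) where
  obj A := Convexity.StdSimplex ℝ A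
  map f := ↾(Convexity.StdSimplex.map f)
  map_id A := by ext x : 3; exact Convexity.StdSimplex.map_id x
  map_comp f g := by ext x : 3; exact Convexity.StdSimplex.map_comp x f g
  η := { app := fun A => ↾Convexity.StdSimplex.single
         naturality := fun A B f => by
          ext x : 3; exact (Convexity.StdSimplex.map_single x f).symm }
  μ := { app := fun A => ↾Convexity.StdSimplex.join
         naturality := fun A B f => by
          ext x : 3; exact (Convexity.StdSimplex.map_sConvexComb x f).symm }
  assoc A := by ext x : 3; exact (Convexity.sConvexComb_sConvexComb x).symm
  left_unit A := by
    ext x : 3; exact Convexity.sConvexComb_single (R := ℝ) (M := Convexity.StdSimplex ℝ A) x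
  right_unit A := by
    ext x : 3; exact join_map_single x

/-- The two-point distribution `r · x + r* · y`. -/
noncomputable def mix {A : Type u} (r : Weight) (x y : A) : Convexity.StdSimplex ℝ A :=
  .duple x y r.2.1.le (compl r).2.1.le (add_sub_cancel r.1 1)

end Giry

/-! `D I` is the free convex space on `I`, so `D A ⋆ D B`, whose elements are formal binary convex
combinations, is in bijection with `D (A + B)`: a distribution on `A + B` is concentrated on one
summand, or is a unique proper mixture of a distribution on `A` and one on `B`. The comparison
`D (A ⋆ B) → D A ⋆ D B` takes barycentres in this convex space. Each opmonoidal identity becomes,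
after mapping to the convex space `D (A + B)` (or `D (A + B + C)` for associativity), an equality of
affine maps out of a `D I`, which only has to be checked on point masses. In the algebra `X ⋆ Y` the
element `(r, x, y)` is the convex combination of `ι₁ x` and `ι₂ y`, so a map of algebras out of
`X ⋆ Y` is determined by its restrictions along `ι₁` and `ι₂`. -/

namespace Giry

open Convexity Function

section StdSimplex

variable {R : Type*} [PartialOrder R] [Semiring R] [IsStrictOrderedRing R] {I J Z : Type*}
  [ConvexSpace R Z]

instance isEmpty_stdSimplex [IsEmpty I] : IsEmpty (StdSimplex R I) :=
  ⟨fun p => isEmptyElim p.nonempty.some⟩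

theorem stdSimplex_map_id : (StdSimplex.map id : StdSimplex R I → StdSimplex R I) = id :=
  funext StdSimplex.map_id

theorem stdSimplex_map_injective {f : I → J} (hf : Injective f) :
    Injective (StdSimplex.map f : StdSimplex R I → StdSimplex R J) := fun _ _ h =>
  StdSimplex.ext (Finsupp.mapDomain_injective hf (congrArg StdSimplex.weights h))

theorem exists_map_eq_of_support_subset_range {f : I → J} (p : StdSimplex R J)
    (hp : (p.weights.support : Set J) ⊆ Set.range f) : ∃ q : StdSimplex R I, q.map f = p := by
  obtain ⟨j, hj⟩ := p.support_weights_nonempty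
  have : Nonempty I := ⟨(hp hj).choose⟩
  refine ⟨p.map (invFun f), StdSimplex.ext ?_⟩
  rw [StdSimplex.map_map, StdSimplex.weights_map]
  exact (Finsupp.mapDomain_congr fun j hj => invFun_eq (hp hj)).trans Finsupp.mapDomain_id

theorem isAffineMap_iConvexComb (f : I → Z) :
    IsAffineMap R fun p : StdSimplex R I => p.iConvexComb f where
  map_sConvexComb s := by
    rw [← iConvexComb_id, ← iConvexComb_assoc]
    rfl

theorem isAffineMap_sConvexComb : IsAffineMap R (sConvexComb : StdSimplex R Z → Z) where
  map_sConvexComb := sConvexComb_sConvexComb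

theorem eq_iConvexComb_single_of_isAffineMap {f : StdSimplex R I → Z} (hf : IsAffineMap R f)
    (p : StdSimplex R I) : f p = p.iConvexComb (f ∘ StdSimplex.single) := by
  have hp : p.iConvexComb StdSimplex.single = p := by
    ext1
    simp
  rw [← hf.map_iConvexComb, hp]

theorem iConvexComb_single_comp (f : I → J) (p : StdSimplex R I) :
    p.iConvexComb (StdSimplex.single ∘ f) = p.map f := by
  simpa [comp_def] using
    (eq_iConvexComb_single_of_isAffineMap (StdSimplex.isAffineMap_map R f) p).symm

end StdSimplex

theorem add_compl (r : Weight) : r.1 + (compl r).1 = 1 :=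
  add_sub_cancel r.1 1

theorem iConvexComb_mix {A : Type u} {Z : Type*} [ConvexSpace ℝ Z] (r : Weight) (x y : A)
    (f : A → Z) : (mix r x y).iConvexComb f =
      convexCombPair r.1 (compl r).1 r.2.1.le (compl r).2.1.le (add_compl r) (f x) (f y) :=
  congrArg sConvexComb (StdSimplex.map_duple _ _ _ x y f)

section Copair

variable {X Y X' Y' T : Type u} {Z Z' : Type*} [ConvexSpace ℝ Z] [ConvexSpace ℝ Z']

/-- The map `X ⋆ Y → Z` into a convex space determined by `f : X → Z` and `g : Y → Z`, which reads
`(r, x, y)` as the convex combination of `f x` and `g y` with weights `r` and `r*`. -/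
noncomputable def copair (f : X → Z) (g : Y → Z) : Star X Y → Z
  | .inl x => f x
  | .inr (.inl (r, x, y)) =>
      convexCombPair r.1 (compl r).1 r.2.1.le (compl r).2.1.le (add_compl r) (f x) (g y)
  | .inr (.inr y) => g y

theorem copair_starMap (f : X' → Z) (g : Y' → Z) (u : X → X') (v : Y → Y') (z : Star X Y) :
    copair f g (starMap u v z) = copair (f ∘ u) (g ∘ v) z := by
  rcases z with x | ⟨r, x, y⟩ | y <;> rfl

theorem comp_copair {h : Z → Z'} (hh : IsAffineMap ℝ h) (f : X → Z) (g : Y → Z) :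
    h ∘ copair f g = copair (h ∘ f) (h ∘ g) := by
  funext z
  rcases z with x | ⟨r, x, y⟩ | y
  · rfl
  · exact hh.map_convexCombPair ..
  · rfl

theorem copair_swapFun (f : X → Z) (g : Y → Z) (z : Star X Y) :
    copair g f (swapFun z) = copair f g z := by
  rcases z with x | ⟨r, x, y⟩ | y
  · rfl
  · simp only [swapFun, copair, compl_compl]
    exact convexCombPair_symm ..
  · rfl

theorem copair_assocFun (f : X → Z) (g : Y → Z) (h : T → Z) (z : Star (Star X Y) T) :
    copair f (copair g h) (assocFun z) = copair (copair f g) h z := by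
  rcases z with (x | ⟨r, x, y⟩ | y) | ⟨r, x | ⟨s, x, y⟩ | y, t⟩ | t <;> try rfl
  have hrs := mul_ne_one' r s
  have hv : (compl r).1 * (vSnd r s).1 = r.1 * (compl s).1 * (compl (vSnd r s)).1 := by
    simp only [compl, vSnd]
    field_simp
    ring
  have hc : r.1 * (compl s).1 + (compl r).1 = (compl (vFst r s)).1 := by
    simp only [compl, vFst]
    ring
  have assoc := convexCombPair_convexCombPair_assoc_left r.2.1.le (compl r).2.1.le
    (add_compl r) s.2.1.le (compl s).2.1.le (add_compl s) (vSnd r s).2.1.le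
    (compl (vSnd r s)).2.1.le (add_compl _) hv (f x) (g y) (h t)
  simp only [hc] at assoc
  exact assoc.symm

end Copair

section Split

variable {A B A' B' C : Type u} {Z : Type*} [ConvexSpace ℝ Z]

/-- The comparison map `D A ⋆ D B → D (A + B)`. -/
noncomputable def toSum : Star (StdSimplex ℝ A) (StdSimplex ℝ B) → StdSimplex ℝ (A ⊕ B) :=
  copair (StdSimplex.map Sum.inl) (StdSimplex.map Sum.inr)

theorem iConvexComb_toSum (f : A ⊕ B → Z) (z : Star (StdSimplex ℝ A) (StdSimplex ℝ B)) :
    (toSum z).iConvexComb f =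
      copair (·.iConvexComb (f ∘ Sum.inl)) (·.iConvexComb (f ∘ Sum.inr)) z := by
  refine (congrFun (comp_copair (isAffineMap_iConvexComb f) _ _) z).trans ?_
  congr 1 <;> exact funext fun p => iConvexComb_map p _ f

theorem weights_toSum_inl (r : Weight) (p : StdSimplex ℝ A) (q : StdSimplex ℝ B) (a : A) :
    (toSum (.inr (.inl (r, p, q)))).weights (.inl a) = r.1 * p.weights a := by
  rw [toSum, copair, StdSimplex.weights_convexCombPair]
  simp [Finsupp.mapDomain_apply Sum.inl_injective, Finsupp.mapDomain_of_notMem_range]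

theorem weights_toSum_inr (r : Weight) (p : StdSimplex ℝ A) (q : StdSimplex ℝ B) (b : B) :
    (toSum (.inr (.inl (r, p, q)))).weights (.inr b) = (compl r).1 * q.weights b := by
  rw [toSum, copair, StdSimplex.weights_convexCombPair]
  simp [Finsupp.mapDomain_apply Sum.inr_injective, Finsupp.mapDomain_of_notMem_range]

theorem toSum_injective :
    Injective (toSum : Star (StdSimplex ℝ A) (StdSimplex ℝ B) → StdSimplex ℝ (A ⊕ B)) := by
  intro z z' h
  have weight_eq : copair (fun _ => (1 : ℝ)) (fun _ => 0) z =
      copair (fun _ => (1 : ℝ)) (fun _ => 0) z' := by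
    have := congrArg (·.iConvexComb (Sum.elim (fun _ => (1 : ℝ)) fun _ => 0)) h
    simpa only [iConvexComb_toSum, Function.comp_def, Sum.elim_inl, Sum.elim_inr,
      iConvexComb_const] using this
  rcases z with p | ⟨r, p, q⟩ | q <;> rcases z' with p' | ⟨r', p', q'⟩ | q' <;>
    simp only [copair, convexCombPair_eq_sum, smul_eq_mul, mul_one, mul_zero, add_zero,
      one_ne_zero, zero_ne_one] at weight_eq
  · rw [stdSimplex_map_injective Sum.inl_injective h]
  · exact absurd weight_eq r'.2.2.ne'
  · exact absurd weight_eq r.2.2.ne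
  · obtain rfl : r = r' := Subtype.ext weight_eq
    have hp : p = p' := StdSimplex.ext <| Finsupp.ext fun a => mul_left_cancel₀ r.2.1.ne' <| by
      rw [← weights_toSum_inl r p q, h, weights_toSum_inl]
    have hq : q = q' := StdSimplex.ext <| Finsupp.ext fun b =>
      mul_left_cancel₀ (compl r).2.1.ne' <| by
        rw [← weights_toSum_inr r p q, h, weights_toSum_inr]
    rw [hp, hq]
  · exact absurd weight_eq r.2.1.ne'
  · exact absurd weight_eq r'.2.1.ne
  · rw [stdSimplex_map_injective Sum.inr_injective h]

theorem convexCombPair_mem_range_toSum {s t : ℝ} (hs : 0 ≤ s) (ht : 0 ≤ t) (hst : s + t = 1)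
    (p : StdSimplex ℝ A) (q : StdSimplex ℝ B) :
    convexCombPair s t hs ht hst (p.map Sum.inl) (q.map Sum.inr) ∈ Set.range toSum := by
  obtain rfl : t = 1 - s := eq_sub_of_add_eq' hst
  obtain rfl | hs0 := hs.eq_or_lt
  · exact ⟨.inr (.inr q), by simp [toSum, copair]⟩
  obtain rfl | hs1 := (sub_nonneg.1 ht).eq_or_lt
  · exact ⟨.inl p, by simp [toSum, copair]⟩
  · exact ⟨.inr (.inl (⟨s, hs0, hs1⟩, p, q)), rfl⟩

theorem toSum_surjective :
    Surjective (toSum : Star (StdSimplex ℝ A) (StdSimplex ℝ B) → StdSimplex ℝ (A ⊕ B)) := by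
  classical
  intro w
  by_cases hl : ∃ i ∈ Set.range Sum.inl, w.weights i ≠ 0
  · by_cases hr : ∃ i ∈ (Set.range Sum.inl)ᶜ, w.weights i ≠ 0
    · obtain ⟨p, hp⟩ := exists_map_eq_of_support_subset_range (f := Sum.inl)
        (w.restrict _ hl) fun i hi => by
          simp_all [StdSimplex.support_weights_restrict]
      obtain ⟨q, hq⟩ := exists_map_eq_of_support_subset_range (f := Sum.inr)
        (w.restrict _ hr) fun i hi => by
          simp_all [StdSimplex.support_weights_restrict]
      have hw := StdSimplex.convexCombPair_restrict_restrict_compl w _ hl hr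
      rw [← hp, ← hq] at hw
      exact hw ▸ convexCombPair_mem_range_toSum _ _ _ p q
    · obtain ⟨p, hp⟩ := exists_map_eq_of_support_subset_range (f := Sum.inl) w fun i hi =>
        by_contra fun h => hr ⟨i, h, Finsupp.mem_support_iff.1 hi⟩
      exact ⟨.inl p, hp⟩
  · obtain ⟨q, hq⟩ := exists_map_eq_of_support_subset_range (f := Sum.inr) w fun i hi => by
      rw [← Set.compl_range_inl]
      exact fun h => hl ⟨i, h, Finsupp.mem_support_iff.1 hi⟩
    exact ⟨.inr (.inr q), hq⟩

/-- The bijection `D A ⋆ D B ≃ D (A + B)`. -/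
noncomputable def starDistEquiv (A B : Type u) :
    Star (StdSimplex ℝ A) (StdSimplex ℝ B) ≃ StdSimplex ℝ (A ⊕ B) :=
  .ofBijective toSum ⟨toSum_injective, toSum_surjective⟩

/-- The comparison map `D (A ⋆ B) → D A ⋆ D B`: it takes the barycentre of a distribution on
`A ⋆ B`, where `A ⋆ B` is mapped to the convex space `D A ⋆ D B ≃ D (A + B)` by the point masses. -/
noncomputable def split (p : StdSimplex ℝ (Star A B)) : Star (StdSimplex ℝ A) (StdSimplex ℝ B) :=
  (starDistEquiv A B).symm
    (p.iConvexComb (copair (StdSimplex.single ∘ Sum.inl) (StdSimplex.single ∘ Sum.inr)))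

theorem toSum_split (p : StdSimplex ℝ (Star A B)) :
    toSum (split p) =
      p.iConvexComb (copair (StdSimplex.single ∘ Sum.inl) (StdSimplex.single ∘ Sum.inr)) :=
  (starDistEquiv A B).apply_symm_apply _

theorem copair_split {f : StdSimplex ℝ A → Z} (hf : IsAffineMap ℝ f) {g : StdSimplex ℝ B → Z}
    (hg : IsAffineMap ℝ g) (p : StdSimplex ℝ (Star A B)) :
    copair f g (split p) =
      p.iConvexComb (copair (f ∘ StdSimplex.single) (g ∘ StdSimplex.single)) := by
  let F : A ⊕ B → Z := Sum.elim (f ∘ StdSimplex.single) (g ∘ StdSimplex.single)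
  have hF : IsAffineMap ℝ fun w : StdSimplex ℝ (A ⊕ B) => w.iConvexComb F :=
    isAffineMap_iConvexComb F
  calc copair f g (split p)
    _ = copair (·.iConvexComb (F ∘ Sum.inl)) (·.iConvexComb (F ∘ Sum.inr)) (split p) := by
      congr 1 <;> funext p
      · exact eq_iConvexComb_single_of_isAffineMap hf p
      · exact eq_iConvexComb_single_of_isAffineMap hg p
    _ = (toSum (split p)).iConvexComb F := (iConvexComb_toSum F _).symm
    _ = p.iConvexComb (copair (f ∘ StdSimplex.single) (g ∘ StdSimplex.single)) := by
      rw [toSum_split, hF.map_iConvexComb, comp_copair hF]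
      simp [Function.comp_def, F]

theorem isAffineMap_copair_split {f : StdSimplex ℝ A → Z} (hf : IsAffineMap ℝ f)
    {g : StdSimplex ℝ B → Z} (hg : IsAffineMap ℝ g) :
    IsAffineMap ℝ fun p : StdSimplex ℝ (Star A B) => copair f g (split p) := by
  simpa only [copair_split hf hg] using isAffineMap_iConvexComb _

theorem copair_starMap_sConvexComb_split {X Y : Type u} [ConvexSpace ℝ X] [ConvexSpace ℝ Y]
    {f : X → Z} (hf : IsAffineMap ℝ f) {g : Y → Z} (hg : IsAffineMap ℝ g)
    (p : StdSimplex ℝ (Star X Y)) :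
    copair f g (starMap sConvexComb sConvexComb (split p)) = p.iConvexComb (copair f g) := by
  rw [copair_starMap, copair_split (hf.comp isAffineMap_sConvexComb)
    (hg.comp isAffineMap_sConvexComb)]
  simp only [comp_def, sConvexComb_single]

theorem split_single (z : Star A B) :
    split (StdSimplex.single z) = starMap StdSimplex.single StdSimplex.single z := by
  apply toSum_injective
  rw [toSum_split, iConvexComb_single, toSum, copair_starMap]
  congr 1 <;> ext1 <;> simp

theorem split_map (f : A → A') (g : B → B') (p : StdSimplex ℝ (Star A B)) :
    split (p.map (starMap f g)) = starMap (StdSimplex.map f) (StdSimplex.map g) (split p) := by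
  apply toSum_injective
  have hf : IsAffineMap ℝ (StdSimplex.map (Sum.inl (β := B')) ∘ StdSimplex.map f) :=
    (StdSimplex.isAffineMap_map ..).comp (StdSimplex.isAffineMap_map ..)
  have hg : IsAffineMap ℝ (StdSimplex.map (Sum.inr (α := A')) ∘ StdSimplex.map g) :=
    (StdSimplex.isAffineMap_map ..).comp (StdSimplex.isAffineMap_map ..)
  rw [toSum_split, iConvexComb_map, toSum, copair_starMap, copair_split hf hg]
  simp only [copair_starMap, comp_def, StdSimplex.map_single]

theorem split_swap (p : StdSimplex ℝ (Star A B)) :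
    split (p.map swapFun) = swapFun (split p) := by
  apply toSum_injective
  have hl := StdSimplex.isAffineMap_map ℝ (Sum.inl (α := B) (β := A))
  have hr := StdSimplex.isAffineMap_map ℝ (Sum.inr (α := B) (β := A))
  rw [toSum_split, iConvexComb_map, toSum, copair_swapFun, copair_split hr hl]
  simp only [copair_swapFun, comp_def, StdSimplex.map_single]

theorem split_join (p : StdSimplex ℝ (StdSimplex ℝ (Star A B))) :
    split p.join = starMap StdSimplex.join StdSimplex.join (split (p.map split)) := by
  apply toSum_injective
  have hl : IsAffineMap ℝ (StdSimplex.map (Sum.inl (α := A) (β := B)) ∘ StdSimplex.join) :=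
    (StdSimplex.isAffineMap_map ..).comp isAffineMap_sConvexComb
  have hr : IsAffineMap ℝ (StdSimplex.map (Sum.inr (α := A) (β := B)) ∘ StdSimplex.join) :=
    (StdSimplex.isAffineMap_map ..).comp isAffineMap_sConvexComb
  calc toSum (split p.join)
    _ = p.iConvexComb (toSum ∘ split) := by
      rw [toSum_split]
      refine ((isAffineMap_iConvexComb _).map_sConvexComb p).trans ?_
      simp only [comp_def, toSum_split, iConvexComb]
    _ = copair (StdSimplex.map Sum.inl ∘ StdSimplex.join) (StdSimplex.map Sum.inr ∘ StdSimplex.join)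
        (split (p.map split)) := by
      rw [copair_split hl hr, iConvexComb_map]
      simp [comp_def, toSum]
    _ = toSum (starMap StdSimplex.join StdSimplex.join (split (p.map split))) :=
      (copair_starMap ..).symm

theorem split_map_inl (p : StdSimplex ℝ A) :
    split (p.map Sum.inl : StdSimplex ℝ (Star A B)) = .inl p := by
  apply toSum_injective
  rw [toSum_split, iConvexComb_map]
  exact iConvexComb_single_comp Sum.inl p

theorem split_map_inr (p : StdSimplex ℝ B) :
    split (p.map (Sum.inr ∘ Sum.inr) : StdSimplex ℝ (Star A B)) = .inr (.inr p) := by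
  apply toSum_injective
  rw [toSum_split, iConvexComb_map]
  exact iConvexComb_single_comp Sum.inr p

theorem split_mix (r : Weight) (a : A) (b : B) :
    split (mix r (.inl a : Star A B) (.inr (.inr b))) =
      .inr (.inl (r, StdSimplex.single a, StdSimplex.single b)) := by
  apply toSum_injective
  rw [toSum_split, iConvexComb_mix]
  simp [toSum, copair]

theorem starMap_sConvexComb_split_mix {X Y : Type u} [ConvexSpace ℝ X] [ConvexSpace ℝ Y]
    (r : Weight) (x : X) (y : Y) :
    starMap sConvexComb sConvexComb (split (mix r (.inl x : Star X Y) (.inr (.inr y)))) =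
      .inr (.inl (r, x, y)) := by
  simp only [split_mix, starMap, Sum.map_inr, Sum.map_inl, Prod.map_apply, id, sConvexComb_single]

theorem eq_copair_of_forall_split {X Y : Type u} [ConvexSpace ℝ X] [ConvexSpace ℝ Y]
    {h : Star X Y → Z}
    (hh : ∀ p, h (starMap sConvexComb sConvexComb (split p)) = p.iConvexComb h) (z : Star X Y) :
    h z = copair (h ∘ .inl) (h ∘ .inr ∘ .inr) z := by
  rcases z with x | ⟨r, x, y⟩ | y
  · rfl
  · rw [← starMap_sConvexComb_split_mix, hh, starMap_sConvexComb_split_mix]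
    exact iConvexComb_mix ..
  · rfl

theorem copair_copair_split {f : StdSimplex ℝ A → Z} (hf : IsAffineMap ℝ f)
    {g : StdSimplex ℝ B → Z} (hg : IsAffineMap ℝ g) {h : StdSimplex ℝ C → Z}
    (hh : IsAffineMap ℝ h) (p : StdSimplex ℝ (Star (Star A B) C)) :
    copair (copair f g) h (starMap split id (split p)) =
      copair f (copair g h) (starMap id split (split (p.map assocFun))) := by
  have hl := copair_split (isAffineMap_copair_split hf hg) hh p
  have hr := copair_split hf (isAffineMap_copair_split hg hh) (p.map assocFun)
  rw [copair_starMap, copair_starMap]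
  refine hl.trans (.trans ?_ hr.symm)
  rw [iConvexComb_map]
  simp only [comp_def, split_single, copair_starMap, copair_assocFun]

theorem copair_map_copair_map (z : Star (StdSimplex ℝ A) (Star (StdSimplex ℝ B) (StdSimplex ℝ C))) :
    copair (StdSimplex.map (R := ℝ) Sum.inl)
        (copair (StdSimplex.map (Sum.inr ∘ Sum.inl)) (StdSimplex.map (Sum.inr ∘ Sum.inr))) z =
      toSum (starMap id toSum z) := by
  rw [toSum, copair_starMap, toSum, comp_copair (StdSimplex.isAffineMap_map ..)]
  simp only [comp_def, StdSimplex.map_map, id]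

theorem split_assoc (p : StdSimplex ℝ (Star (Star A B) C)) :
    assocFun (starMap split id (split p)) = starMap id split (split (p.map assocFun)) := by
  have starMap_id_toSum_injective :
      Injective (starMap (id : StdSimplex ℝ A → StdSimplex ℝ A) (toSum (A := B) (B := C))) :=
    injective_id.sumMap
      ((injective_id.prodMap (injective_id.prodMap toSum_injective)).sumMap toSum_injective)
  apply starMap_id_toSum_injective
  apply toSum_injective
  rw [← copair_map_copair_map, ← copair_map_copair_map, copair_assocFun]
  exact copair_copair_split (StdSimplex.isAffineMap_map ..) (StdSimplex.isAffineMap_map ..)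
    (StdSimplex.isAffineMap_map ..) p

end Split

section Opmonoidal

attribute [local instance] monoidal symmetric

/-- The opmonoidal structure of `D` with `υ_{A,B} = split`; the unit component exists because `∅`
carries no probability distribution. -/
noncomputable abbrev oplaxMonoidal : monad.{u}.toFunctor.OplaxMonoidal where
  η := ↾fun p : StdSimplex ℝ PEmpty.{u + 1} => isEmptyElim p
  δ A B := ↾fun p : StdSimplex ℝ (Star A B) => split p
  δ_natural_left f B := by
    ext p
    have h := split_map f (id : B → B) p
    rw [stdSimplex_map_id] at h
    exact h.symm
  δ_natural_right A f := by
    ext p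
    have h := split_map (id : A → A) f p
    rw [stdSimplex_map_id] at h
    exact h.symm
  oplax_associativity A B C := by ext p; exact split_assoc p
  oplax_left_unitality A := by
    ext p
    exact (congrArg (starMap _ id) (split_map_inr p)).symm
  oplax_right_unitality A := by
    ext p
    exact (congrArg (starMap id _) (split_map_inl p)).symm

/-- `D` as a symmetric opmonoidal monad for the Giry monoidal structure. -/
noncomputable abbrev opmonoidalMonad : SymmetricOpmonoidalMonad monad.{u} where
  oplax := oplaxMonoidal
  braided A B := by ext p; exact (split_swap p).symm
  unit_counit := by ext p; exact p.elim
  unit_tensor A B := by ext z; exact split_single z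
  mul_counit := by ext p; exact isEmptyElim (α := StdSimplex ℝ (StdSimplex ℝ PEmpty.{u + 1})) p
  mul_tensor A B := by ext p; exact split_join p

end Opmonoidal

section Algebra

/-- The convex space underlying a `D`-algebra. -/
noncomputable instance (X : monad.{u}.Algebra) : ConvexSpace ℝ X.A where
  sConvexComb p := X.a p
  sConvexComb_single x := ConcreteCategory.congr_hom X.unit x
  assoc p := (ConcreteCategory.congr_hom X.assoc p).symm

theorem isAffineMap_hom {X Y : monad.{u}.Algebra} (f : X ⟶ Y) : IsAffineMap ℝ f.f where
  map_sConvexComb p := (ConcreteCategory.congr_hom f.h p).symm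

end Algebra

section Coproducts

attribute [local instance] monoidal symmetric

variable (X Y : monad.{u}.Algebra)

/-- The algebra `X ⋆ Y`. -/
noncomputable def starAlgebra : monad.{u}.Algebra := opmonoidalMonad.tensorAlgebra X Y

/-- The coproduct injection `ι₁`. -/
noncomputable def starInl : X ⟶ starAlgebra X Y where
  f := ↾(Sum.inl : X.A → Star X.A Y.A)
  h := by ext p; exact congrArg (starMap X.a Y.a) (split_map_inl p)

/-- The coproduct injection `ι₂`. -/
noncomputable def starInr : Y ⟶ starAlgebra X Y where
  f := ↾(Sum.inr ∘ Sum.inr : Y.A → Star X.A Y.A)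
  h := by ext p; exact congrArg (starMap X.a Y.a) (split_map_inr p)

theorem starAlgebra_a_mix (r : Weight) (x : X.A) (y : Y.A) :
    (starAlgebra X Y).a (mix r (.inl x : Star X.A Y.A) (.inr (.inr y))) =
      (.inr (.inl (r, x, y)) : Star X.A Y.A) :=
  starMap_sConvexComb_split_mix r x y

variable {X Y}

/-- The map of algebras `X ⋆ Y ⟶ Z` induced by `f` and `g`. -/
noncomputable def starDesc {Z : monad.{u}.Algebra} (f : X ⟶ Z) (g : Y ⟶ Z) :
    starAlgebra X Y ⟶ Z where
  f := ↾(copair f.f g.f)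
  h := by
    ext p
    exact (copair_starMap_sConvexComb_split (isAffineMap_hom f) (isAffineMap_hom g) p).symm

theorem eq_starDesc {Z : monad.{u}.Algebra} (h : starAlgebra X Y ⟶ Z) :
    h = starDesc (starInl X Y ≫ h) (starInr X Y ≫ h) :=
  Monad.Algebra.Hom.ext <| by
    ext z
    exact eq_copair_of_forall_split (isAffineMap_hom h).map_sConvexComb z

/-- `X ⋆ Y` is the coproduct of the algebras `X` and `Y`. -/
noncomputable def isColimitStar : IsColimit (BinaryCofan.mk (starInl X Y) (starInr X Y)) :=
  BinaryCofan.isColimitMk (fun s => starDesc s.inl s.inr)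
    (fun _ => rfl) (fun _ => rfl) (fun _ h hl hr => by rw [eq_starDesc h, hl, hr])

/-- The unit algebra is initial. -/
noncomputable def isInitialUnitAlgebra : IsInitial opmonoidalMonad.{u}.unitAlgebra :=
  IsInitial.ofUniqueHom
    (fun _ =>
      { f := ↾PEmpty.elim
        h := by ext p; exact isEmptyElim (α := StdSimplex ℝ PEmpty.{u + 1}) p })
    (fun _ _ => Monad.Algebra.Hom.ext (by ext e; exact e.elim))

/-- The finite Giry monad as a linear exponential monad. -/
noncomputable def linearExponentialMonad : LinearExponentialMonad monad.{u} where
  toSymmetricOpmonoidalMonad := opmonoidalMonad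
  coproducts :=
    letI := opmonoidalMonad.{u}.liftedMonoidal
    letI := opmonoidalMonad.{u}.liftedSymmetric
    { isInitialUnit := isInitialUnitAlgebra
      inl := starInl
      inr := starInr
      isColimit := fun _ _ => isColimitStar
      inl_tensorHom := fun _ _ => rfl
      inr_tensorHom := fun _ _ => rfl
      inr_leftUnitor := fun _ => rfl
      inl_rightUnitor := fun _ => rfl
      inl_inl_associator := fun _ _ _ => rfl
      inr_inl_associator := fun _ _ _ => rfl
      inr_associator := fun _ _ _ => rfl
      inl_braiding := fun _ _ => rfl
      inr_braiding := fun _ _ => rfl }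

end Coproducts

end Giry

theorem SymmetricOpmonoidalMonad.isStrictSymmetricMonoidal_forget {C : Type u} [Category.{v} C]
    [MonoidalCategory C] [SymmetricCategory C] {T : Monad C}
    (S : SymmetricOpmonoidalMonad T) :
    letI := S.liftedMonoidal
    letI := S.liftedSymmetric
    IsStrictSymmetricMonoidal (Monad.forget T) :=
  letI := S.liftedMonoidal
  letI := S.liftedSymmetric
  { unit := rfl
    tensor := fun _ _ => rfl
    tensorHom := fun _ _ => ((Category.id_comp _).trans (Category.comp_id _)).symm
    associator := fun _ _ _ => ((Category.id_comp _).trans (Category.comp_id _)).symm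
    leftUnitor := fun _ => (Category.id_comp _).symm
    rightUnitor := fun _ => (Category.id_comp _).symm
    braiding := fun _ _ => ((Category.id_comp _).trans (Category.comp_id _)).symm }

theorem mainTheorem1 :
    letI := Giry.monoidal.{u}
    letI := Giry.symmetric.{u}
    ∃ L : LinearExponentialMonad Giry.monad.{u},
      letI := L.liftedMonoidal
      letI := L.liftedSymmetric
      IsStrictSymmetricMonoidal (Monad.forget Giry.monad.{u}) ∧
      ∀ X Y : Giry.monad.{u}.Algebra,
        (∀ x : X.A, (L.coproducts.inl X Y).f x = (Sum.inl x : Giry.Star X.A Y.A)) ∧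
        (∀ y : Y.A, (L.coproducts.inr X Y).f y = (Sum.inr (Sum.inr y) : Giry.Star X.A Y.A)) ∧
        ∀ (r : Giry.Weight) (x : X.A) (y : Y.A),
          (X ⊗ Y).a (Giry.mix r (Sum.inl x : Giry.Star X.A Y.A) (Sum.inr (Sum.inr y))) =
            (Sum.inr (Sum.inl (r, x, y)) : Giry.Star X.A Y.A) := by
  let := Giry.monoidal.{u}
  let := Giry.symmetric.{u}
  exact ⟨Giry.linearExponentialMonad,
    SymmetricOpmonoidalMonad.isStrictSymmetricMonoidal_forget _,
    fun X Y => ⟨fun _ => rfl, fun _ => rfl, Giry.starAlgebra_a_mix X Y⟩⟩
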